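/- Let $Z$ be a simply connected (finite-dimensional, Hausdorff) complex manifold, and let $\mathcal G$ be a subgroup of the group $\mathrm{Aut}(Z)$ of biholomorphic self-maps of $Z$ such that (i) $\mathcal G$ acts properly discontinuously on $Z$ (for all compact $K,L\subset Z$, only finitely many $g\in\mathcal G$ satisfy $gK\cap L\neq\emptyset$; in particular $\mathcal G$ is discrete in $\mathrm{Aut}(Z)$); (ii) the stabilizer $\mathrm{Stab}(z)\subset\mathcal G$ is finite for every $z\in Z$; (iii) for every $g\in\mathcal G\setminus\{1\}$ the fixed locus $\mathrm{Fix}(g)=\{z\in Z: gz=z\}$ has complex codimension at least $2$ in $Z$ (the empty set having codimension $\infty$). Let $Y=Z/\mathcal G$ with the quotient map $\pi:Z\to Y$, regarded as a complex space whose holomorphic functions on an open set $V\subset Y$ are the functions $f$ such that $f\circ\pi$ is holomorphic on $\pi^{-1}(V)$. Let $Y_{\mathrm{reg}}\subset Y$ be its regular part, i.e. the set of points having an open neighbourhood isomorphic to an open subset of $\mathbb C^n$, $n=\dim Z$. Let $U\subset Y$ be any open subset containing $Y_{\mathrm{reg}}$, and let $$N_U=\Big\langle \bigcup_{z\in\pi^{-1}(U)}\mathrm{Stab}(z)\Big\rangle\subset\mathcal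 G .$$ Then $U$ is non-empty and path-connected (so that its fundamental group does not depend, up to isomorphism, on the base point), $N_U$ is a normal subgroup of $\mathcal G$, and $\pi_1(U)\cong\mathcal G/N_U$. -/

import Mathlib

open scoped Manifold ContDiff

/-- The group `Aut(Z)` of biholomorphic self-maps of a complex manifold `Z` modelled on `E`.
Over `ℂ`, smoothness of order `ω` means complex analytic, i.e. holomorphic. -/
def HolAut (E : Type*) [NormedAddCommGroup E] [NormedSpace ℂ E]
    (Z : Type*) [TopologicalSpace Z] [ChartedSpace E Z] : Subgroup (Equiv.Perm Z) where
  carrier := {f | ContMDiff 𝓘(ℂ, E) 𝓘(ℂ, E) ω (f : Z → Z) ∧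
    ContMDiff 𝓘(ℂ, E) 𝓘(ℂ, E) ω (f.symm : Z → Z)}
  mul_mem' := fun {_ _} hf hg => ⟨hf.1.comp hg.1, hg.2.comp hf.2⟩
  one_mem' := ⟨contMDiff_id, contMDiff_id⟩
  inv_mem' := fun {_} hf => ⟨hf.2, hf.1⟩

/-- Near the point `z ∈ S`, the set `S` is a complex submanifold of `Z` modelled on the linear
subspace `W` of `E`: some holomorphic chart around `z` carries `S` to `W`. Such points `z` are the
regular points of `S`, and the codimension of `S` at such a point is `dim E ⧸ W`. -/
def IsSubmanifoldAt {E : Type*} [NormedAddCommGroup E] [NormedSpace ℂ E]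
    {Z : Type*} [TopologicalSpace Z] [ChartedSpace E Z]
    (S : Set Z) (z : Z) (W : Submodule ℂ E) : Prop :=
  z ∈ S ∧ ∃ φ ∈ IsManifold.maximalAtlas 𝓘(ℂ, E) ω Z,
    z ∈ φ.source ∧ ∀ x ∈ φ.source, x ∈ S ↔ φ x ∈ W

/-- The complex codimension in `Z` of an analytic subset `S`: the infimum of its codimensions at
its regular points (which are dense in `S`). The empty set has codimension `⊤`. -/
noncomputable def analyticCodim (E : Type*) [NormedAddCommGroup E] [NormedSpace ℂ E]
    {Z : Type*} [TopologicalSpace Z] [ChartedSpace E Z] (S : Set Z) : ℕ∞ :=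
  ⨅ (z : Z) (W : Submodule ℂ E) (_ : IsSubmanifoldAt S z W), (Module.finrank ℂ (E ⧸ W) : ℕ∞)

section Quotient

variable {E : Type*} [NormedAddCommGroup E] [NormedSpace ℂ E]
  {Z : Type*} [TopologicalSpace Z] [ChartedSpace E Z]

/-- The quotient `Y = Z / 𝒢`, the space of orbits, with the quotient topology. -/
abbrev OrbitSpace (𝒢 : Subgroup (HolAut E Z)) : Type _ :=
  Quotient (MulAction.orbitRel 𝒢 Z)

/-- The natural surjection `π : Z → Z / 𝒢`. -/
def orbitProj (𝒢 : Subgroup (HolAut E Z)) (z : Z) : OrbitSpace 𝒢 :=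
  Quotient.mk (MulAction.orbitRel 𝒢 Z) z

/-- The structure sheaf of the complex space `Y = Z / 𝒢`: a function `f` is holomorphic on the
open set `V ⊆ Y` if `f ∘ π` is holomorphic on `π⁻¹(V)`, so that sections over `V` are the
`𝒢`-invariant holomorphic functions on `π⁻¹(V)`. (Only the values of `f` on `V` matter.) -/
def IsHolomorphicOnQuotient (𝒢 : Subgroup (HolAut E Z)) (f : OrbitSpace 𝒢 → ℂ)
    (V : Set (OrbitSpace 𝒢)) : Prop :=
  ContMDiffOn 𝓘(ℂ, E) 𝓘(ℂ, ℂ) ω (f ∘ orbitProj 𝒢) (orbitProj 𝒢 ⁻¹' V)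

/-- The regular part `Y_reg` of the complex space `Y = Z / 𝒢`: the points with an open
neighbourhood that is isomorphic, as a space with a sheaf of holomorphic functions, to an open
subset of `E`. -/
def regularLocus (𝒢 : Subgroup (HolAut E Z)) : Set (OrbitSpace 𝒢) :=
  {y | ∃ φ : OpenPartialHomeomorph (OrbitSpace 𝒢) E, y ∈ φ.source ∧
    ∀ V : Set (OrbitSpace 𝒢), IsOpen V → V ⊆ φ.source → ∀ f : OrbitSpace 𝒢 → ℂ,
      IsHolomorphicOnQuotient 𝒢 f V ↔ ContDiffOn ℂ ω (f ∘ φ.symm) (φ '' V)}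

/-- `N_U`: the subgroup of `𝒢` generated by the stabilizers of all points of `π⁻¹(U)`. -/
def stabilizerSubgroup (𝒢 : Subgroup (HolAut E Z)) (U : Set (OrbitSpace 𝒢)) : Subgroup 𝒢 :=
  Subgroup.closure (⋃ z ∈ orbitProj 𝒢 ⁻¹' U, (MulAction.stabilizer 𝒢 z : Set 𝒢))

end Quotient

/-! Let S = π⁻¹(U). A point with trivial stabilizer maps to a regular point
(`orbitProj_mem_regularLocus`), so the closed set Z ∖ S consists of points fixed by some g ≠ 1.
Averaging a chart over a finite stabilizer linearizes the action near a point
(`exists_linearizing_chart`), and the fixed loci become linear subspaces of complex codimension at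
least 2, hence of real codimension at least 4. Deleting a relatively closed part of finitely many
such subspaces from a convex open set leaves it simply connected
(`Convex.isSimplyConnected_of_diff_subset_iUnion`). This local fact globalizes
(`simplyConnectedSpace_of_local_preimage`), so S is simply connected.

Now U is the orbit space of S, and Armstrong's argument applies
(`nonempty_fundamentalGroup_orbitSpace_mulEquiv`). Paths lift to S up to homotopy, and an element
with a fixed point does not change the class of a projected path, so S/N_U is simply connected. The
residual action of 𝒢/N_U on S/N_U is a covering action with quotient U, whence π₁(U) ≅ 𝒢/N_U. Both
halves rest on neighbourhoods that contract equivariantly, namely the linear charts. -/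

open Set Topology unitInterval

/-! ### Homotopy classes of paths from small pieces -/

section PathInduction

variable {X : Type*} [TopologicalSpace X]

/-- A property of homotopy classes of paths which is stable under concatenation and holds for all
sufficiently small paths holds for all paths. -/
theorem Path.Homotopic.Quotient.induction_of_local
    (P : ∀ a b : X, Path.Homotopic.Quotient a b → Prop)
    (trans : ∀ (a b c : X) (p : Path.Homotopic.Quotient a b) (q : Path.Homotopic.Quotient b c),
      P a b p → P b c q → P a c (p.trans q))
    (loc : ∀ x : X, ∃ V ∈ 𝓝 x, ∀ (a b : X) (γ : Path a b), range γ ⊆ V →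
      P a b (Path.Homotopic.Quotient.mk γ))
    {a b : X} (p : Path.Homotopic.Quotient a b) : P a b p := by
  induction p with | mk γ =>
  choose V hV hloc using loc
  obtain ⟨t, t0, hmono, ⟨n, hn⟩, ht⟩ := exists_monotone_Icc_subset_open_cover_unitInterval
    (c := fun x : X ↦ γ ⁻¹' interior (V x)) (fun x ↦ isOpen_interior.preimage γ.continuous)
    (fun s _ ↦ mem_iUnion.2 ⟨γ s, mem_interior_iff_mem_nhds.2 (hV _)⟩)
  have small : ∀ s s' : I, s ≤ s' → (∃ x, Icc s s' ⊆ γ ⁻¹' interior (V x)) →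
      P _ _ (Path.Homotopic.Quotient.mk (γ.subpath s s')) := by
    rintro s s' hs ⟨x, hx⟩
    apply hloc x
    rw [Path.range_subpath_of_le _ _ _ hs]
    exact image_subset_iff.2 (hx.trans (preimage_mono interior_subset))
  have key : ∀ m, P _ _ (Path.Homotopic.Quotient.mk (γ.subpath 0 (t m))) := by
    intro m
    induction m with
    | zero =>
      apply small _ _ (by simp)
      refine ⟨γ 0, ?_⟩
      rw [t0, Icc_self, singleton_subset_iff]
      exact mem_interior_iff_mem_nhds.2 (hV _)
    | succ m ih =>
      have := trans _ _ _ _ _ ih (small _ _ (hmono m.le_succ) (ht m))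
      rwa [← Path.Homotopic.Quotient.mk_trans,
        Path.Homotopic.Quotient.eq.2 ⟨Path.Homotopy.subpathTransSubpath γ 0 (t m) (t (m + 1))⟩]
        at this
  -- The subpath from 0 to 1 runs from `γ 0` to `γ 1`, which equal `a` and `b` only propositionally.
  have cast : ∀ (a' b' : X) (h : a' = a) (h' : b' = b),
      P a' b' (Path.Homotopic.Quotient.mk (γ.cast h h')) →
      P a b (Path.Homotopic.Quotient.mk γ) := by
    rintro a' b' rfl rfl h; exact h
  have := key n
  rw [hn n le_rfl, Path.subpath_zero_one] at this
  exact cast _ _ _ _ this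

/-- The homotopy class of paths between two points of a simply connected subset. -/
noncomputable def IsSimplyConnected.pathClass {S : Set X} (hS : IsSimplyConnected S) {x y : X}
    (hx : x ∈ S) (hy : y ∈ S) : Path.Homotopic.Quotient x y :=
  have := hS.simplyConnectedSpace
  (Path.Homotopic.Quotient.mk (PathConnectedSpace.somePath (⟨x, hx⟩ : S) ⟨y, hy⟩)).map
    ⟨Subtype.val, continuous_subtype_val⟩

theorem IsSimplyConnected.mk_eq_pathClass {S : Set X} (hS : IsSimplyConnected S) {x y : X}
    (γ : Path x y) (h : range γ ⊆ S) :
    Path.Homotopic.Quotient.mk γ = hS.pathClass (h ⟨0, γ.source⟩) (h ⟨1, γ.target⟩) := by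
  have := hS.simplyConnectedSpace
  let γ' : Path (⟨x, h ⟨0, γ.source⟩⟩ : S) ⟨y, h ⟨1, γ.target⟩⟩ :=
    { toFun := fun t ↦ ⟨γ t, h ⟨t, rfl⟩⟩
      continuous_toFun := by fun_prop
      source' := by simp
      target' := by simp }
  have : γ = γ'.map continuous_subtype_val := by ext t; rfl
  conv_lhs => rw [this]
  exact Path.Homotopic.Quotient.eq.2
    ((SimplyConnectedSpace.paths_homotopic γ' _).map ⟨Subtype.val, continuous_subtype_val⟩)

theorem IsSimplyConnected.exists_path {S : Set X} (hS : IsSimplyConnected S) {x y : X}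
    (hx : x ∈ S) (hy : y ∈ S) : ∃ γ : Path x y, range γ ⊆ S := by
  obtain ⟨γ, hγ⟩ := hS.isPathConnected.joinedIn x hx y hy
  exact ⟨γ, by rintro _ ⟨t, rfl⟩; exact hγ t⟩

theorem IsSimplyConnected.mk_eq_mk {S : Set X} (hS : IsSimplyConnected S) {x y : X}
    (γ γ' : Path x y) (h : range γ ⊆ S) (h' : range γ' ⊆ S) :
    Path.Homotopic.Quotient.mk γ = Path.Homotopic.Quotient.mk γ' := by
  rw [hS.mk_eq_pathClass γ h, hS.mk_eq_pathClass γ' h']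

theorem IsSimplyConnected.pathClass_trans {S : Set X} (hS : IsSimplyConnected S) {x y z : X}
    (hx : x ∈ S) (hy : y ∈ S) (γ : Path y z) (h : range γ ⊆ S) :
    hS.pathClass hx (h ⟨1, γ.target⟩) =
      (hS.pathClass hx hy).trans (Path.Homotopic.Quotient.mk γ) := by
  obtain ⟨δ, hδ⟩ := hS.exists_path hx hy
  have hδγ : range (δ.trans γ) ⊆ S := by
    rw [Path.trans_range]
    exact union_subset hδ h
  rw [← hS.mk_eq_pathClass δ hδ, ← Path.Homotopic.Quotient.mk_trans,
    hS.mk_eq_pathClass (δ.trans γ) hδγ]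

end PathInduction

/-! ### From local to global simple connectedness -/

section LocallySimplyConnectedPreimages

open CategoryTheory

variable {X Z : Type*} [TopologicalSpace X] [TopologicalSpace Z]

/-- Sending z to the path component containing the preimage of a small neighbourhood of z is locally
constant on the connected space Z, hence constant. -/
theorem pathConnectedSpace_of_local_preimage [ConnectedSpace Z] (f : C(X, Z))
    (h : ∀ z : Z, ∀ W ∈ 𝓝 z, ∃ B ⊆ W, IsOpen B ∧ z ∈ B ∧ IsPathConnected (f ⁻¹' B)) :
    PathConnectedSpace X := by
  choose B hBW hBo hzB hB using fun z ↦ h z univ Filter.univ_mem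
  choose x hx using fun z ↦ (hB z).nonempty
  let c : Z → ZerothHomotopy X := fun z ↦ Quotient.mk _ (x z)
  have hc : ∀ z y, f y ∈ B z → Quotient.mk (pathSetoid X) y = c z := fun z y hy ↦
    Quotient.sound ((hB z).joinedIn y hy _ (hx z)).joined
  have hloc : IsLocallyConstant c := by
    rw [IsLocallyConstant.iff_eventually_eq]
    intro z
    filter_upwards [(hBo z).mem_nhds (hzB z)] with z' hz'
    obtain ⟨B', hB'W, -, -, hB'⟩ := h z' (B z ∩ B z') (((hBo z).inter (hBo z')).mem_nhds
      ⟨hz', hzB z'⟩)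
    obtain ⟨y, hy⟩ := hB'.nonempty
    rw [← hc z y (hB'W hy).1, ← hc z' y (hB'W hy).2]
  have z₀ : Z := Classical.choice inferInstance
  refine ⟨⟨x z₀⟩, fun y y' ↦ Quotient.exact (s := pathSetoid X) ?_⟩
  rw [hc (f y) y (hzB _), hc (f y') y' (hzB _)]
  exact hloc.apply_eq_of_isPreconnected isPreconnected_univ (mem_univ _) (mem_univ _)

/-- If a simply connected space has arbitrarily small open sets around every point whose preimages
under `f : X → Z` are simply connected, then `X` is simply connected. -/
theorem simplyConnectedSpace_of_local_preimage [SimplyConnectedSpace Z]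
    [LocallyPathConnectedSpace Z] (f : C(X, Z))
    (h : ∀ z : Z, ∀ W ∈ 𝓝 z, ∃ B ⊆ W, IsOpen B ∧ z ∈ B ∧ IsSimplyConnected (f ⁻¹' B)) :
    SimplyConnectedSpace X := by
  have hpc : PathConnectedSpace X := pathConnectedSpace_of_local_preimage f fun z W hW ↦ by
    obtain ⟨B, hBW, hBo, hzB, hB⟩ := h z W hW
    exact ⟨B, hBW, hBo, hzB, hB.isPathConnected⟩
  have x₀ : X := Classical.choice inferInstance
  choose B hBW hBo hzB hB using fun z ↦ h z univ Filter.univ_mem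
  choose x hx using fun z ↦ (hB z).nonempty
  have hne : ∀ z, (Filter.comap f (𝓝 z)).NeBot := fun z ↦ by
    rw [Filter.comap_neBot_iff]
    intro W hW
    obtain ⟨B', hB'W, -, -, hB'⟩ := h z W hW
    obtain ⟨y, hy⟩ := hB'.nonempty
    exact ⟨y, hB'W hy⟩
  have hself : ∀ (P : X → Prop) (y : X), (∀ᶠ y' in Filter.comap f (𝓝 (f y)), P y') → P y :=
    fun P y hP ↦ (Filter.eventually_comap.1 hP).self_of_nhds y rfl
  -- local primitives
  have he : ∀ i : Z, ∃ e : ∀ y : X, FundamentalGroupoid.mk x₀ ⟶ FundamentalGroupoid.mk y,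
      ∀ (y y' : X) (γ : Path y y'), range γ ⊆ f ⁻¹' B i →
        e y' = e y ≫ (Path.Homotopic.Quotient.mk γ : FundamentalGroupoid.mk y ⟶ .mk y') := by
    intro i
    classical
    refine ⟨fun y ↦ if hy : y ∈ f ⁻¹' B i then
      (Path.Homotopic.Quotient.mk (PathConnectedSpace.somePath x₀ (x i)) :
        FundamentalGroupoid.mk x₀ ⟶ .mk (x i)) ≫ ((hB i).pathClass (hx i) hy :
        FundamentalGroupoid.mk (x i) ⟶ .mk y)
      else Path.Homotopic.Quotient.mk (PathConnectedSpace.somePath x₀ y), fun y y' γ hγ ↦ ?_⟩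
    have hy : y ∈ f ⁻¹' B i := hγ ⟨0, γ.source⟩
    have hy' : y' ∈ f ⁻¹' B i := hγ ⟨1, γ.target⟩
    beta_reduce
    rw [dif_pos hy, dif_pos hy', Category.assoc, (hB i).pathClass_trans (hx i) hy γ hγ]
    rfl
  choose e he using he
  let F := FundamentalGroupoid.mk x₀ ⟶ FundamentalGroupoid.mk x₀
  -- Two local primitives differ by an automorphism of `x₀` that is constant along paths over `B i ∩
  -- B j`. These differences form a cocycle, to be trivialized over the simply connected Z.
  let c : Z → Z → X → F := fun i j y ↦ e i y ≫ inv (e j y)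
  have hc : ∀ i j z, z ∈ B i ∩ B j → ∃ v : F, ∀ᶠ y in Filter.comap f (𝓝 z), c i j y = v := by
    intro i j z hz
    obtain ⟨B', hB'W, hB'o, hzB', hB'⟩ := h z _ (((hBo i).inter (hBo j)).mem_nhds hz)
    obtain ⟨y, hy⟩ := hB'.nonempty
    refine ⟨c i j y, Filter.mem_of_superset (Filter.preimage_mem_comap (hB'o.mem_nhds hzB')) ?_⟩
    intro y' hy'
    obtain ⟨γ, hγ⟩ := hB'.exists_path hy hy'
    simp only [mem_ofPred_eq, c]
    rw [he i y y' γ (fun _ ha ↦ (hB'W (hγ ha)).1), he j y y' γ (fun _ ha ↦ (hB'W (hγ ha)).2)]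
    simp
  classical
  -- The cocycle must live on Z, but z may lie outside the range of f. Its value is therefore the
  -- germ of `c i j` along `Filter.comap f (𝓝 z)`, a proper filter by `hne`.
  let C : Z → Z → Z → F := fun i j z ↦ if hz : z ∈ B i ∩ B j then (hc i j z hz).choose else 𝟙 _
  have hC : ∀ i j z, z ∈ B i ∩ B j → ∀ᶠ y in Filter.comap f (𝓝 z), c i j y = C i j z := by
    intro i j z hz
    simp only [C, dif_pos hz]
    exact (hc i j z hz).choose_spec
  have hC_eq : ∀ i j z v, z ∈ B i ∩ B j → (∀ᶠ y in Filter.comap f (𝓝 z), c i j y = v) →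
      C i j z = v := by
    intro i j z v hz hv
    have := hne z
    obtain ⟨y, hy, hy'⟩ := ((hC i j z hz).and hv).exists
    rw [← hy, hy']
  have hC_loc : ∀ i j z, z ∈ B i ∩ B j → ∀ᶠ z' in 𝓝 z, C i j z' = C i j z := by
    intro i j z hz
    have h1 := Filter.eventually_comap.1 (hC i j z hz)
    filter_upwards [h1.eventually_nhds, ((hBo i).inter (hBo j)).mem_nhds hz] with z' h1' hz'
    exact hC_eq _ _ _ _ hz' (Filter.eventually_comap.2 h1')
  let : TopologicalSpace F := ⊥
  have : DiscreteTopology F := ⟨rfl⟩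
  -- With discrete fibre this bundle is a covering of Z, so the identity of Z lifts to a global
  -- section `s`. Read in the trivializations, `s` gives locally constant corrections `ρ i`.
  let core : FiberBundleCore Z Z F :=
    { baseSet := B
      isOpen_baseSet := hBo
      indexAt := id
      mem_baseSet_at := hzB
      coordChange := fun i j z v ↦ v ≫ C i j z
      coordChange_self := by
        intro i z hz v
        rw [hC_eq i i z (𝟙 _) ⟨hz, hz⟩ (Filter.Eventually.of_forall fun y ↦ by simp [c]),
          Category.comp_id]
      continuousOn_coordChange := by
        rintro i j ⟨z, v⟩ ⟨hz, -⟩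
        have h1 : ContinuousAt (C i j) z := by
          rw [ContinuousAt, nhds_discrete F]
          exact Filter.tendsto_pure.2 (hC_loc i j z hz)
        have h2 : ContinuousAt (fun p : F × F ↦ p.1 ≫ p.2) (v, C i j z) :=
          continuous_of_discreteTopology.continuousAt
        have h3 : ContinuousAt (fun p : Z × F ↦ C i j p.1) (z, v) :=
          ContinuousAt.comp (f := Prod.fst) (g := C i j) h1 continuousAt_fst
        exact (h2.comp (f := fun p : Z × F ↦ (p.2, C i j p.1)) (x := (z, v))
          (continuousAt_snd.prodMk h3)).continuousWithinAt
      coordChange_comp := by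
        rintro i j k z ⟨⟨hi, hj⟩, hk⟩ v
        rw [hC_eq i k z (C i j z ≫ C j k z) ⟨hi, hk⟩, Category.assoc]
        filter_upwards [hC i j z ⟨hi, hj⟩, hC j k z ⟨hj, hk⟩] with y h1 h2
        simp [← h1, ← h2, c] }
  have cov : IsCoveringMap (Bundle.TotalSpace.proj : core.TotalSpace → Z) :=
    FiberBundle.isCoveringMap (F := F) (E := core.Fiber)
  obtain ⟨s, ⟨-, hs⟩, -⟩ := cov.existsUnique_continuousMap_lifts (ContinuousMap.id Z) (f x₀)
    (⟨f x₀, (𝟙 _ : F)⟩ : core.TotalSpace) rfl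
  have hs' : ∀ z, (s z).proj = z := fun z ↦ congrFun hs z
  let ρ : Z → Z → F := fun i z ↦ (core.localTriv i (s z)).2
  have hρ_loc : ∀ i z, z ∈ B i → ∀ᶠ z' in 𝓝 z, ρ i z' = ρ i z := by
    intro i z hz
    have h1 : ContinuousAt (core.localTriv i) (s z) :=
      (core.localTriv i).continuousOn_toFun.continuousAt
        ((core.localTriv i).open_source.mem_nhds (by
          rw [FiberBundleCore.mem_localTriv_source, hs']; exact hz))
    have h2 : ContinuousAt (ρ i) z := continuousAt_snd.comp (h1.comp s.continuous.continuousAt)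
    rw [ContinuousAt, nhds_discrete F] at h2
    exact Filter.tendsto_pure.1 h2
  have hρ : ∀ i j z, z ∈ B i ∩ B j → ρ j z = ρ i z ≫ C i j z := by
    intro i j z hz
    simp only [ρ, FiberBundleCore.localTriv_apply]
    have key : ∀ p : core.TotalSpace, p.proj = z →
        core.coordChange (core.indexAt p.proj) j p.proj p.2 =
        core.coordChange (core.indexAt p.proj) i p.proj p.2 ≫ C i j z := by
      rintro p rfl
      exact (core.coordChange_comp (core.indexAt p.proj) i j p.proj
        ⟨⟨core.mem_baseSet_at _, hz.1⟩, hz.2⟩ p.2).symm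
    exact key _ (hs' z)
  -- The corrected primitives `ρ i ≫ e i` agree on overlaps. The resulting global primitive
  -- satisfies `τ b = τ a ≫ p` for every class `p`, so `p` is determined by its endpoints.
  let τ : ∀ y : X, FundamentalGroupoid.mk x₀ ⟶ FundamentalGroupoid.mk y :=
    fun y ↦ ρ (f y) (f y) ≫ e (f y) y
  have hτ : ∀ i y, f y ∈ B i → τ y = ρ i (f y) ≫ e i y := by
    intro i y hy
    simp only [τ]
    rw [hρ i (f y) (f y) ⟨hy, hzB _⟩, ← hself _ _ (hC i (f y) (f y) ⟨hy, hzB _⟩)]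
    simp [c]
  have main : ∀ (a b : X) (p : Path.Homotopic.Quotient a b),
      τ b = τ a ≫ (p : FundamentalGroupoid.mk a ⟶ .mk b) := by
    intro a b p
    refine p.induction_of_local (fun a b p ↦ τ b = τ a ≫ (p : FundamentalGroupoid.mk a ⟶ .mk b))
      ?_ ?_
    · intro a b c p q hp hq
      rw [hq, hp, Category.assoc]
      rfl
    · intro y
      refine ⟨{y' | f y' ∈ B (f y) ∧ ρ (f y) (f y') = ρ (f y) (f y)},
        f.continuous.continuousAt (((hBo _).mem_nhds (hzB (f y))) |> fun h1 ↦
          Filter.inter_mem h1 (hρ_loc (f y) (f y) (hzB _))), fun a b γ hγ ↦ ?_⟩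
      have ha := hγ ⟨0, γ.source⟩
      have hb := hγ ⟨1, γ.target⟩
      rw [hτ (f y) a ha.1, hτ (f y) b hb.1, ha.2, hb.2, he (f y) a b γ fun _ h ↦ (hγ h).1,
        Category.assoc]
  rw [simply_connected_iff_paths_homotopic]
  refine ⟨hpc, fun a b ↦ ⟨fun p q ↦ ?_⟩⟩
  have := (main a b p).symm.trans (main a b q)
  exact (cancel_epi (τ a)).1 this

end LocallySimplyConnectedPreimages

/-! ### Complements of linear subspaces in convex open sets -/

section RemovalOfSubspaces

variable {E : Type*} [NormedAddCommGroup E] [NormedSpace ℝ E]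

theorem Convex.isSimplyConnected_preimage_val {O K : Set E} (hK : Convex ℝ K)
    (hne : K.Nonempty) (hKO : K ⊆ O) : IsSimplyConnected (Subtype.val ⁻¹' K : Set O) := by
  rw [← Topology.IsEmbedding.subtypeVal.isSimplyConnected_image, Subtype.image_preimage_coe,
    inter_eq_right.2 hKO]
  have := hK.contractibleSpace hne
  exact SimplyConnectedSpace.ofContractible K

/-- `IsStraight γ` says that the path `γ` in `O` parametrizes a line segment affinely. -/
def IsStraight {O : Set E} {x y : O} (γ : Path x y) : Prop :=
  ∀ t, (γ t : E) = AffineMap.lineMap (x : E) (y : E) (t : ℝ)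

theorem IsStraight.eq {O : Set E} {x y : O} {γ γ' : Path x y} (h : IsStraight γ)
    (h' : IsStraight γ') : γ = γ' := by
  ext t; rw [h t, h' t]

theorem IsStraight.symm {O : Set E} {x y : O} {γ : Path x y} (h : IsStraight γ) :
    IsStraight γ.symm := by
  intro t
  rw [Path.symm_apply, Function.comp_apply, h, unitInterval.coe_symm_eq, AffineMap.lineMap_apply_one_sub]

theorem Convex.exists_isStraight {O K : Set E} (hK : Convex ℝ K) (hKO : K ⊆ O) (x y : O)
    (hx : (x : E) ∈ K) (hy : (y : E) ∈ K) :
    ∃ γ : Path x y, IsStraight γ ∧ range γ ⊆ Subtype.val ⁻¹' K := by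
  have h : ∀ t : I, AffineMap.lineMap (x : E) (y : E) (t : ℝ) ∈ K := fun t ↦
    hK.segment_subset hx hy (by
      rw [segment_eq_image_lineMap]; exact ⟨t, t.2, rfl⟩)
  refine ⟨{ toFun := fun t ↦ ⟨AffineMap.lineMap (x : E) (y : E) (t : ℝ), hKO (h t)⟩
            continuous_toFun := by
              refine Continuous.subtype_mk ?_ _
              exact AffineMap.lineMap_continuous.comp continuous_subtype_val
            source' := by simp
            target' := by simp }, fun t ↦ rfl, ?_⟩
  rintro _ ⟨t, rfl⟩
  exact h t

/-- A proper subspace is closed with empty interior, so finitely many complements have dense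
intersection. -/
theorem exists_mem_forall_notMem_of_ne_top [FiniteDimensional ℝ E] {D : Set E} (hDo : IsOpen D)
    (hne : D.Nonempty) {S : Set (Submodule ℝ E)} (hS : S.Finite) (hS' : ∀ W ∈ S, W ≠ ⊤) :
    ∃ c ∈ D, ∀ W ∈ S, c ∉ W := by
  have := FiniteDimensional.complete ℝ E
  have hd : Dense (⋂ W ∈ S, ((W : Set E)ᶜ)) := by
    refine dense_biInter_of_isOpen (fun W _ ↦ W.closed_of_finiteDimensional.isOpen_compl)
      hS.countable fun W hW ↦ interior_eq_empty_iff_dense_compl.1 ?_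
    by_contra h
    exact hS' W hW (W.eq_top_of_nonempty_interior' (nonempty_iff_ne_empty.2 h))
  obtain ⟨c, hc, hc'⟩ := hd.inter_open_nonempty D hDo hne
  exact ⟨c, hc, fun W hW ↦ mem_iInter₂.1 hc' W hW⟩

/-- Removing from a convex open set a relatively closed subset of a finite union of linear subspaces
of real codimension at least three leaves a simply connected set. -/
theorem Convex.isSimplyConnected_of_diff_subset_iUnion [FiniteDimensional ℝ E] {D O : Set E}
    (hD : Convex ℝ D) (hDo : IsOpen D) (hne : D.Nonempty) (hO : IsOpen O) (hOD : O ⊆ D)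
    {ι : Type*} [Finite ι] (W : ι → Submodule ℝ E)
    (hW : ∀ i p q, W i ⊔ Submodule.span ℝ {p, q} ≠ ⊤) (hDO : D \ O ⊆ ⋃ i, (W i : Set E)) :
    IsSimplyConnected O := by
  -- If `c` lies outside W + span(p, q), the cone from `c` over the segment [p, q] can meet W only
  -- on that segment.
  let generic : Set (E × E) → E → Prop := fun T c ↦
    ∀ pq ∈ T, ∀ i, c ∉ W i ⊔ Submodule.span ℝ {pq.1, pq.2}
  have exists_generic : ∀ T : Set (E × E), T.Finite → ∃ c : O, generic T c := by
    intro T hT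
    let S : Set (Submodule ℝ E) :=
      -- The extra pair (0, 0) keeps `c` off each `W i` itself, even when `T` is empty; hence `c ∈
      -- O`.
      ⋃ i, (fun pq : E × E ↦ W i ⊔ Submodule.span ℝ {pq.1, pq.2}) '' insert (0, 0) T
    have hS : S.Finite := finite_iUnion fun i ↦ (hT.insert _).image _
    obtain ⟨c, hc, hcS⟩ := exists_mem_forall_notMem_of_ne_top hDo hne hS (by
      rintro V hV
      obtain ⟨i, pq, -, rfl⟩ := mem_iUnion.1 hV
      exact hW i _ _)
    have hcO : c ∈ O := by
      by_contra hcO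
      obtain ⟨i, hi⟩ := mem_iUnion.1 (hDO ⟨hc, hcO⟩)
      exact hcS _ (mem_iUnion.2 ⟨i, (0, 0), mem_insert _ _, rfl⟩) (Submodule.mem_sup_left hi)
    exact ⟨⟨c, hcO⟩, fun pq hpq i ↦
      hcS _ (mem_iUnion.2 ⟨i, pq, mem_insert_of_mem _ hpq, rfl⟩)⟩
  have triangle : ∀ (a b c : E), c ∈ D → segment ℝ a b ⊆ O → generic {(a, b)} c →
      convexHull ℝ {c, a, b} ⊆ O := by
    intro a b c hc hab hgen z hz
    have hzD : z ∈ D := by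
      refine convexHull_min ?_ hD hz
      rintro y (rfl | rfl | rfl)
      exacts [hc, hOD (hab (left_mem_segment ℝ _ _)), hOD (hab (right_mem_segment ℝ _ _))]
    rw [convexHull_insert ⟨a, by simp⟩, convexHull_pair, mem_convexJoin] at hz
    obtain ⟨c', hc', w, hw, s, t, hs, ht, hst, rfl⟩ := hz
    rw [mem_singleton_iff] at hc'
    subst hc'
    by_contra hzO
    rcases hs.eq_or_lt with rfl | hs
    · simp only [zero_add] at hst
      subst hst
      simp only [zero_smul, one_smul, zero_add] at hzO
      exact hzO (hab hw)
    obtain ⟨i, hi⟩ := mem_iUnion.1 (hDO ⟨hzD, hzO⟩)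
    refine hgen (a, b) rfl i ?_
    have hw' : w ∈ Submodule.span ℝ {a, b} := by
      obtain ⟨u, v, -, -, -, rfl⟩ := hw
      exact Submodule.mem_span_pair.2 ⟨u, v, rfl⟩
    have : c' = s⁻¹ • ((s • c' + t • w) - t • w) := by
      rw [add_sub_cancel_right, smul_smul, inv_mul_cancel₀ hs.ne', one_smul]
    rw [this]
    exact Submodule.smul_mem _ _ (Submodule.sub_mem _ (Submodule.mem_sup_left hi)
      (Submodule.smul_mem _ _ (Submodule.mem_sup_right hw')))
  have cone : ∀ (a b : O), ∃ T : Set (E × E), T.Finite ∧ ∀ c : O, generic T c →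
      (∃ γ : Path a c, IsStraight γ) ∧ ∃ γ : Path b c, IsStraight γ := by
    intro a b
    refine ⟨{((a : E), (a : E)), ((b : E), (b : E))}, by simp, fun c hc ↦ ⟨?_, ?_⟩⟩
    · obtain ⟨γ, hγ, -⟩ := (convex_convexHull ℝ _).exists_isStraight
        (triangle a a c (hOD c.2) (by simp) (fun pq hpq ↦ hc pq (Or.inl hpq))) a c
        (subset_convexHull _ _ (by simp)) (subset_convexHull _ _ (by simp))
      exact ⟨γ, hγ⟩
    · obtain ⟨γ, hγ, -⟩ := (convex_convexHull ℝ _).exists_isStraight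
        (triangle b b c (hOD c.2) (by simp) (fun pq hpq ↦ hc pq (Or.inr hpq))) b c
        (subset_convexHull _ _ (by simp)) (subset_convexHull _ _ (by simp))
      exact ⟨γ, hγ⟩
  -- For all generic `c`, a class is the straight path to `c` followed by the straight path from
  -- `c`. Under concatenation the two middle legs cancel, being the same segment traversed both
  -- ways. Two classes with the same endpoints then agree through a common generic `c`.
  have main : ∀ (a b : O) (p : Path.Homotopic.Quotient a b), ∃ T : Set (E × E), T.Finite ∧
      ∀ c : O, generic T c → ∃ (γ : Path a c) (δ : Path c b), IsStraight γ ∧ IsStraight δ ∧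
        p = Path.Homotopic.Quotient.mk (γ.trans δ) := by
    intro a b p
    refine p.induction_of_local (fun a b p ↦ ∃ T : Set (E × E), T.Finite ∧
      ∀ c : O, generic T c → ∃ (γ : Path a c) (δ : Path c b), IsStraight γ ∧ IsStraight δ ∧
        p = Path.Homotopic.Quotient.mk (γ.trans δ)) ?_ ?_
    · rintro a b c p q ⟨T, hT, hp⟩ ⟨T', hT', hq⟩
      refine ⟨T ∪ T', hT.union hT', fun d hd ↦ ?_⟩
      obtain ⟨γ, δ, hγ, hδ, rfl⟩ := hp d fun pq h ↦ hd pq (Or.inl h)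
      obtain ⟨γ', δ', hγ', hδ', rfl⟩ := hq d fun pq h ↦ hd pq (Or.inr h)
      refine ⟨γ, δ', hγ, hδ', ?_⟩
      rw [hγ'.eq hδ.symm]
      simp only [Path.Homotopic.Quotient.mk_trans, Path.Homotopic.Quotient.mk_symm]
      rw [Path.Homotopic.Quotient.trans_assoc, ← Path.Homotopic.Quotient.trans_assoc _ _
        (Path.Homotopic.Quotient.mk δ'), Path.Homotopic.Quotient.trans_symm,
        Path.Homotopic.Quotient.refl_trans]
    · intro x
      obtain ⟨r, hr, hrO⟩ := Metric.isOpen_iff.1 hO x x.2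
      refine ⟨Subtype.val ⁻¹' Metric.ball (x : E) r,
        (Metric.isOpen_ball.preimage continuous_subtype_val).mem_nhds
          (Metric.mem_ball_self hr), fun a b γ hγ ↦ ?_⟩
      have ha : (a : E) ∈ Metric.ball (x : E) r := hγ ⟨0, γ.source⟩
      have hb : (b : E) ∈ Metric.ball (x : E) r := hγ ⟨1, γ.target⟩
      have hball := convex_ball (x : E) r
      obtain ⟨ε, hε, hεr⟩ := hball.exists_isStraight hrO a b ha hb
      refine ⟨{((a : E), (b : E))}, finite_singleton _, fun c hc ↦ ?_⟩
      have htri := triangle a b c (hOD c.2)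
        ((hball.segment_subset ha hb).trans hrO) hc
      have hK := convex_convexHull ℝ {(c : E), (a : E), (b : E)}
      have hcK : (c : E) ∈ convexHull ℝ {(c : E), (a : E), (b : E)} :=
        subset_convexHull _ _ (by simp)
      have haK : (a : E) ∈ convexHull ℝ {(c : E), (a : E), (b : E)} :=
        subset_convexHull _ _ (by simp)
      have hbK : (b : E) ∈ convexHull ℝ {(c : E), (a : E), (b : E)} :=
        subset_convexHull _ _ (by simp)
      obtain ⟨γ₁, h₁, hr₁⟩ := hK.exists_isStraight htri a c haK hcK
      obtain ⟨γ₂, h₂, hr₂⟩ := hK.exists_isStraight htri c b hcK hbK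
      obtain ⟨ε', hε', hεr'⟩ := hK.exists_isStraight htri a b haK hbK
      refine ⟨γ₁, γ₂, h₁, h₂, ?_⟩
      -- The short path is first straightened inside the ball, and the segment is then pushed across
      -- the triangle with apex `c`.
      rw [(hball.isSimplyConnected_preimage_val ⟨_, ha⟩ hrO).mk_eq_mk γ ε hγ hεr, hε.eq hε']
      refine (hK.isSimplyConnected_preimage_val ⟨_, haK⟩ htri).mk_eq_mk _ _ hεr' ?_
      rw [Path.trans_range]
      exact union_subset hr₁ hr₂
  refine simply_connected_iff_paths_homotopic.2 ⟨⟨?_, fun a b ↦ ?_⟩, fun a b ↦ ⟨fun p q ↦ ?_⟩⟩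
  · obtain ⟨c, -⟩ := exists_generic ∅ finite_empty
    exact ⟨c⟩
  · obtain ⟨T, hT, h⟩ := cone a b
    obtain ⟨c, hc⟩ := exists_generic T hT
    obtain ⟨⟨γ, -⟩, δ, -⟩ := h c hc
    exact ⟨γ.trans δ.symm⟩
  · obtain ⟨T, hT, hp⟩ := main a b p
    obtain ⟨T', hT', hq⟩ := main a b q
    obtain ⟨c, hc⟩ := exists_generic (T ∪ T') (hT.union hT')
    obtain ⟨γ, δ, hγ, hδ, rfl⟩ := hp c fun pq h ↦ hc pq (Or.inl h)
    obtain ⟨γ', δ', hγ', hδ', rfl⟩ := hq c fun pq h ↦ hc pq (Or.inr h)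
    rw [hγ.eq hγ', hδ.eq hδ']

/-- Otherwise the images of p and q would span E ⧸ W over ℝ, whose real dimension is at least 4. -/
theorem Submodule.restrictScalars_sup_span_pair_ne_top {E : Type*} [NormedAddCommGroup E]
    [NormedSpace ℂ E] (W : Submodule ℂ E) (hW : 2 ≤ Module.finrank ℂ (E ⧸ W)) (p q : E) :
    W.restrictScalars ℝ ⊔ Submodule.span ℝ {p, q} ≠ ⊤ := by
  intro h
  let f : E →ₗ[ℝ] E ⧸ W := W.mkQ.restrictScalars ℝ
  have h1 : Submodule.span ℝ (range ![f p, f q]) = ⊤ := by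
    have h2 := congrArg (Submodule.map f) h
    have hf : f.range = ⊤ := LinearMap.range_eq_top.2 W.mkQ_surjective
    rw [Submodule.map_sup, Submodule.map_top, hf,
      Submodule.map_span, image_pair] at h2
    rw [Matrix.range_cons_cons_empty, ← h2, eq_comm, sup_eq_right]
    rintro _ ⟨w, hw, rfl⟩
    have : f w = 0 := (Submodule.Quotient.mk_eq_zero W).2 hw
    rw [this]
    exact Submodule.zero_mem _
  have h3 := finrank_le_of_span_eq_top h1
  rw [finrank_real_of_complex] at h3
  simp at h3
  omega

end RemovalOfSubspaces

/-! ### Functoriality of path classes -/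

section HomotopyClasses

variable {X Y : Type*} [TopologicalSpace X] [TopologicalSpace Y]

/-- Needed because f (g • x) and f x are equal only propositionally, so projected classes are
compared by `HEq`. -/
theorem Path.Homotopic.Quotient.trans_heq {a b c a' b' c' : X}
    {p : Path.Homotopic.Quotient a b} {q : Path.Homotopic.Quotient b c}
    {p' : Path.Homotopic.Quotient a' b'} {q' : Path.Homotopic.Quotient b' c'}
    (ha : a = a') (hb : b = b') (hc : c = c') (hp : p ≍ p') (hq : q ≍ q') :
    p.trans q ≍ p'.trans q' := by
  subst ha hb hc
  rw [eq_of_heq hp, eq_of_heq hq]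

theorem Path.Homotopic.Quotient.map_trans {a b c : X} (p : Path.Homotopic.Quotient a b)
    (q : Path.Homotopic.Quotient b c) (f : C(X, Y)) :
    (p.trans q).map f = (p.map f).trans (q.map f) := by
  induction p with | mk p =>
  induction q with | mk q =>
  simp only [← Path.Homotopic.Quotient.mk_trans, ← Path.Homotopic.Quotient.mk_map]
  congr 1
  exact p.map_trans q f.continuous

end HomotopyClasses

/-! ### Contractible slices and Armstrong's theorem -/

section Slices

variable (G : Type*) {X : Type*} [TopologicalSpace X] [Group G] [MulAction G X]

/-- `V` is an open neighbourhood of `x` which meets only its translates by elements of the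
stabilizer of `x`, and which contracts equivariantly to `x`. -/
structure IsContractibleSlice (x : X) (V : Set X) : Prop where
  isOpen : IsOpen V
  mem : x ∈ V
  smul_eq : ∀ (g : G) (v : X), v ∈ V → g • v ∈ V → g • x = x
  exists_contraction : ∃ H : C(V × I, V), (∀ v, H (v, 0) = v) ∧ (∀ v, H (v, 1) = ⟨x, mem⟩) ∧
    ∀ (g : G) (v w : V) (t : I), (w : X) = g • (v : X) → (H (w, t) : X) = g • (H (v, t) : X)

variable {G}

theorem IsContractibleSlice.subgroup {x : X} {V : Set X} (h : IsContractibleSlice G x V)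
    (N : Subgroup G) : IsContractibleSlice N x V where
  isOpen := h.isOpen
  mem := h.mem
  smul_eq := fun g v ↦ h.smul_eq g v
  exists_contraction := by
    obtain ⟨H, h0, h1, hH⟩ := h.exists_contraction
    exact ⟨H, h0, h1, fun g ↦ hH g⟩

/-- The equivariant contraction descends to the orbits of V and contracts the image. -/
theorem IsContractibleSlice.isSimplyConnected_image {Y : Type*} [TopologicalSpace Y] {x : X}
    {V : Set X} (h : IsContractibleSlice G x V) {f : X → Y} (hf : IsOpenQuotientMap f)
    (hfG : ∀ x y, f x = f y ↔ x ∈ MulAction.orbit G y) : IsSimplyConnected (f '' V) := by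
  obtain ⟨H, h0, h1, hH⟩ := h.exists_contraction
  let f' : V → f '' V := fun v ↦ ⟨f v, mem_image_of_mem f v.2⟩
  have hf' : IsOpenQuotientMap f' := by
    refine ⟨?_, ?_, ?_⟩
    · rintro ⟨_, v, hv, rfl⟩
      exact ⟨⟨v, hv⟩, rfl⟩
    · exact (hf.continuous.comp continuous_subtype_val).subtype_mk _
    · exact (hf.isOpenMap.comp h.isOpen.isOpenMap_subtype_val).subtype_mk _
  -- The lift is chosen arbitrarily; equivariance of `H` makes the result independent of it, and
  -- continuity is tested after the quotient map `f' × id`.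
  let K : f '' V × I → f '' V := fun p ↦ f' (H (Function.surjInv hf'.surjective p.1, p.2))
  have hK : ∀ v t, K (f' v, t) = f' (H (v, t)) := by
    intro v t
    apply Subtype.ext
    have h2 := congrArg Subtype.val (Function.surjInv_eq hf'.surjective (f' v))
    obtain ⟨g, hg⟩ := (hfG _ _).1 h2
    exact (hfG _ _).2 ⟨g, (hH g v _ t hg.symm).symm⟩
  have hKc : Continuous K := by
    rw [← (hf'.prodMap IsOpenQuotientMap.id).continuous_comp_iff]
    have : K ∘ Prod.map f' id = f' ∘ H := by
      ext ⟨v, t⟩ : 1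
      exact hK v t
    rw [this]
    exact hf'.continuous.comp H.continuous
  have : ContractibleSpace (f '' V) := by
    rw [contractible_iff_id_nullhomotopic]
    refine ⟨f' ⟨x, h.mem⟩, ⟨{ toFun := fun p ↦ K (p.2, p.1)
                              continuous_toFun := hKc.comp continuous_swap
                              map_zero_left := fun y ↦ ?_
                              map_one_left := fun y ↦ ?_ }⟩⟩
    · obtain ⟨v, rfl⟩ := hf'.surjective y
      simp [hK, h0]
    · obtain ⟨v, rfl⟩ := hf'.surjective y
      simp [hK, h1]
  exact SimplyConnectedSpace.ofContractible (f '' V)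

theorem IsContractibleSlice.isSimplyConnected {x : X} {V : Set X}
    (h : IsContractibleSlice G x V) : IsSimplyConnected V := by
  have := (h.subgroup ⊥).isSimplyConnected_image (f := id) IsOpenQuotientMap.id fun x y ↦ by
    constructor
    · rintro rfl
      exact MulAction.mem_orbit_self _
    · rintro ⟨⟨g, hg⟩, rfl⟩
      rw [Subgroup.mem_bot] at hg
      subst hg
      exact one_smul G y
  rwa [image_id] at this

/-- Up to homotopy, every path in an orbit space lifts, provided there are contractible slices. -/
theorem exists_lift_pathClass {Y : Type*} [TopologicalSpace Y] [ContinuousConstSMul G X]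
    (hslice : ∀ x : X, ∃ V, IsContractibleSlice G x V) {f : C(X, Y)} (hf : IsOpenQuotientMap f)
    (hfG : ∀ x y, f x = f y ↔ x ∈ MulAction.orbit G y) {a b : Y}
    (p : Path.Homotopic.Quotient a b) (x : X) (hx : f x = a) :
    ∃ (y : X) (hy : f y = b) (δ : Path.Homotopic.Quotient x y),
      p = (δ.map f).cast hx.symm hy.symm := by
  revert x
  refine p.induction_of_local (fun a b p ↦ ∀ x (hx : f x = a), ∃ (y : X) (hy : f y = b)
    (δ : Path.Homotopic.Quotient x y), p = (δ.map f).cast hx.symm hy.symm) ?_ ?_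
  · rintro a b c p q hp hq x rfl
    obtain ⟨y, rfl, δ, rfl⟩ := hp x rfl
    obtain ⟨z, rfl, δ', rfl⟩ := hq y rfl
    exact ⟨z, rfl, δ.trans δ', by simp [Path.Homotopic.Quotient.map_trans]⟩
  · intro m
    obtain ⟨x₀, rfl⟩ := hf.surjective m
    obtain ⟨V, hV⟩ := hslice x₀
    refine ⟨f '' V, (hf.isOpenMap _ hV.isOpen).mem_nhds (mem_image_of_mem _ hV.mem), ?_⟩
    rintro a b γ hγ x rfl
    obtain ⟨v, hv, hva⟩ := hγ ⟨0, γ.source⟩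
    obtain ⟨w, hw, rfl⟩ := hγ ⟨1, γ.target⟩
    obtain ⟨g, rfl⟩ := (hfG _ _).1 hva.symm
    obtain ⟨δ, hδ⟩ := hV.isSimplyConnected.exists_path hv hw
    have hinv : ∀ u, f (g • u) = f u := fun u ↦ (hfG _ _).2 ⟨g, rfl⟩
    refine ⟨g • w, hinv w, .mk (δ.map (continuous_const_smul g)), ?_⟩
    rw [← Path.Homotopic.Quotient.mk_map, ← Path.Homotopic.Quotient.mk_cast]
    apply (hV.isSimplyConnected_image hf hfG).mk_eq_mk _ _ hγ
    rintro _ ⟨t, rfl⟩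
    exact ⟨δ t, hδ ⟨t, rfl⟩, (hinv _).symm⟩

/-- If the group acting on a simply connected space is generated by elements with fixed points,
then the orbit space is simply connected. -/
theorem simplyConnectedSpace_orbitSpace {Y : Type*} [TopologicalSpace Y]
    [ContinuousConstSMul G X] [SimplyConnectedSpace X]
    (hslice : ∀ x : X, ∃ V, IsContractibleSlice G x V) {f : C(X, Y)} (hf : IsOpenQuotientMap f)
    (hfG : ∀ x y, f x = f y ↔ x ∈ MulAction.orbit G y)
    {S : Set G} (hS : Subgroup.closure S = ⊤) (hfix : ∀ g ∈ S, ∃ x : X, g • x = x) :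
    SimplyConnectedSpace Y := by
  have hinv : ∀ (g : G) u, f (g • u) = f u := fun g u ↦ (hfG _ _).2 ⟨g, rfl⟩
  rw [simply_connected_iff_paths_homotopic]
  refine ⟨hf.surjective.pathConnectedSpace hf.continuous, fun a b ↦ ?_⟩
  obtain ⟨x₀, rfl⟩ := hf.surjective a
  let P : ∀ x y : X, Path.Homotopic.Quotient x y :=
    fun x y ↦ .mk (PathConnectedSpace.somePath x y)
  let τ : ∀ x, Path.Homotopic.Quotient (f x₀) (f x) := fun x ↦ (P x₀ x).map f
  have hτ : ∀ (x y : X) (δ : Path.Homotopic.Quotient x y), τ y = (τ x).trans (δ.map f) := by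
    intro x y δ
    rw [← Path.Homotopic.Quotient.map_trans]
    rw [Subsingleton.elim ((P x₀ x).trans δ) (P x₀ y)]
  -- A path from a fixed point z to x and its g-translate, from z to g • x, have the same
  -- projection.
  have hfixed : ∀ g ∈ S, ∀ x, τ (g • x) ≍ τ x := by
    intro g hg x
    obtain ⟨z, hz⟩ := hfix g hg
    let ε := PathConnectedSpace.somePath z x
    rw [hτ z x (.mk ε), hτ (g • z) (g • x) (.mk (ε.map (continuous_const_smul g)))]
    refine Path.Homotopic.Quotient.trans_heq rfl (hinv g z) (hinv g x) (by rw [hz]) ?_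
    rw [← Path.Homotopic.Quotient.mk_map, ← Path.Homotopic.Quotient.mk_map]
    have : (ε.map (continuous_const_smul g)).map f.continuous =
        (ε.map f.continuous).cast (hinv g z) (hinv g x) := by
      ext t
      exact hinv g (ε t)
    rw [this, Path.Homotopic.Quotient.mk_cast]
    exact Path.Homotopic.Quotient.cast_heq _ _
  have hall : ∀ (g : G) x, τ (g • x) ≍ τ x := by
    intro g
    have hg : g ∈ Subgroup.closure S := hS ▸ Subgroup.mem_top g
    induction hg using Subgroup.closure_induction with
    | mem g hg => exact hfixed g hg
    | one => intro x; rw [one_smul]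
    | mul g h _ _ hg hh => intro x; rw [mul_smul]; exact (hg _).trans (hh x)
    | inv g _ hg => 
      intro x
      have := (hg (g⁻¹ • x)).symm
      rwa [smul_inv_smul] at this
  refine ⟨fun p q ↦ ?_⟩
  obtain ⟨y, hy, δ, hp⟩ := exists_lift_pathClass hslice hf hfG p x₀ rfl
  obtain ⟨z, hz, ε, hq⟩ := exists_lift_pathClass hslice hf hfG q x₀ rfl
  obtain ⟨g, rfl⟩ := (hfG _ _).1 (hy.trans hz.symm)
  have hp' : p ≍ τ (g • z) := by
    rw [hp, Subsingleton.elim δ (P _ _)]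
    exact Path.Homotopic.Quotient.cast_heq _ _
  have hq' : q ≍ τ z := by
    rw [hq, Subsingleton.elim ε (P _ _)]
    exact Path.Homotopic.Quotient.cast_heq _ _
  exact eq_of_heq ((hp'.trans (hall g z)).trans hq'.symm)

/-- The action of `G ⧸ N` on the orbits of a normal subgroup `N`. -/
abbrev quotientMulActionOrbits (N : Subgroup G) [N.Normal] :
    MulAction (G ⧸ N) (MulAction.orbitRel.Quotient N X) where
  smul := Quotient.map₂ (fun (g : G) (x : X) ↦ g • x) (by
    rintro g g' hg x x' ⟨n, rfl⟩
    rw [← Quotient.eq_iff_equiv] at hg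
    have hg' : g⁻¹ * g' ∈ N := QuotientGroup.eq.1 hg
    have h1 : g * n * g'⁻¹ ∈ N := by
      have h2 := Subgroup.Normal.conj_mem ‹N.Normal› _ (N.mul_mem n.2 (N.inv_mem hg')) g
      have h3 : g * (n * (g⁻¹ * g')⁻¹) * g⁻¹ = g * n * g'⁻¹ := by group
      rwa [h3] at h2
    refine ⟨⟨g * n * g'⁻¹, h1⟩, ?_⟩
    change (g * n * g'⁻¹) • g' • x' = g • (n : G) • x'
    simp [mul_smul])
  one_smul := by
    rintro ⟨x⟩
    exact congrArg (Quotient.mk _) (one_smul G x)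
  mul_smul := by
    rintro ⟨g⟩ ⟨h⟩ ⟨x⟩
    exact congrArg (Quotient.mk _) (mul_smul g h x)

/-- Armstrong's theorem: the fundamental group of the orbit space of a simply connected space is the
quotient of the group by the subgroup generated by the elements with fixed points. -/
theorem nonempty_fundamentalGroup_orbitSpace_mulEquiv {Y : Type*} [TopologicalSpace Y]
    [ContinuousConstSMul G X] [SimplyConnectedSpace X]
    (hslice : ∀ x : X, ∃ V, IsContractibleSlice G x V) {f : X → Y} (hf : IsOpenQuotientMap f)
    (hfG : ∀ x y, f x = f y ↔ x ∈ MulAction.orbit G y) (N : Subgroup G) [N.Normal]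
    (hN : N = Subgroup.closure (⋃ x : X, (MulAction.stabilizer G x : Set G))) (y : Y) :
    Nonempty (FundamentalGroup Y y ≃* G ⧸ N) := by
  let M := MulAction.orbitRel.Quotient N X
  let q : C(X, M) := ⟨Quotient.mk (MulAction.orbitRel N X), continuous_quot_mk⟩
  have : ContinuousConstSMul N X := ⟨fun n ↦ continuous_const_smul (n : G)⟩
  have hq : IsOpenQuotientMap q := MulAction.isOpenQuotientMap_quotientMk
  have hqN : ∀ x y, q x = q y ↔ x ∈ MulAction.orbit N y := fun x y ↦ Quotient.eq
  have hfixN : ∀ (x : X) (g : G), g • x = x → g ∈ N := fun x g hg ↦ by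
    rw [hN]
    exact Subgroup.subset_closure (mem_iUnion.2 ⟨x, hg⟩)
  have hM : SimplyConnectedSpace M := by
    refine simplyConnectedSpace_orbitSpace (G := N)
      (fun x ↦ (hslice x).imp fun V hV ↦ hV.subgroup N) hq hqN
      (S := Subtype.val ⁻¹' (⋃ x : X, (MulAction.stabilizer G x : Set G))) ?_ ?_
    · subst hN
      exact Subgroup.closure_closure_coe_preimage
    · rintro g hg
      obtain ⟨x, hx⟩ := mem_iUnion.1 hg
      exact ⟨x, hx⟩
  let _ : MulAction (G ⧸ N) M := quotientMulActionOrbits N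
  have hsmul : ∀ (g : G) (x : X), (g : G ⧸ N) • q x = q (g • x) := fun g x ↦ rfl
  have hfN : ∀ x y, q x = q y → f x = f y := fun x y h ↦ by
    obtain ⟨n, rfl⟩ := (hqN _ _).1 h
    exact (hfG _ _).2 ⟨n, rfl⟩
  let p : M → Y := Quotient.lift f fun x y h ↦ hfN x y (Quotient.sound h)
  have hp : IsOpenQuotientMap p := (hq.of_comp_iff (g := p)).1 hf
  have hcov : IsQuotientCoveringMap p (G ⧸ N) :=
    { hp.isQuotientMap with
      continuous_const_smul := by
        intro g
        obtain ⟨g, rfl⟩ := QuotientGroup.mk_surjective g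
        rw [← hq.continuous_comp_iff]
        exact q.continuous.comp (continuous_const_smul g)
      apply_eq_iff_mem_orbit := by
        intro a b
        obtain ⟨x, rfl⟩ := hq.surjective a
        obtain ⟨y, rfl⟩ := hq.surjective b
        refine (hfG x y).trans ⟨?_, ?_⟩
        · rintro ⟨g, rfl⟩
          exact ⟨g, rfl⟩
        · rintro ⟨g, hg⟩
          obtain ⟨g, rfl⟩ := QuotientGroup.mk_surjective g
          obtain ⟨n, hn⟩ := (hqN _ _).1 (show q (g • y) = q x from hg)
          exact ⟨(n : G)⁻¹ * g, by
            change ((n : G)⁻¹ * g) • y = x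
            rw [mul_smul, inv_smul_eq_iff]; exact hn.symm⟩
      disjoint := by
        intro a
        obtain ⟨x, rfl⟩ := hq.surjective a
        obtain ⟨V, hV⟩ := hslice x
        refine ⟨q '' V, (hq.isOpenMap _ hV.isOpen).mem_nhds (mem_image_of_mem _ hV.mem), ?_⟩
        rintro g ⟨_, ⟨_, ⟨v, hv, rfl⟩, rfl⟩, w, hw, hwv⟩
        obtain ⟨g, rfl⟩ := QuotientGroup.mk_surjective g
        obtain ⟨n, hn⟩ := (hqN _ _).1 (show q w = q (g • v) from hwv)
        rw [QuotientGroup.eq_one_iff]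
        have h1 : ((n : G) * g) • v ∈ V := by
          rw [mul_smul]
          exact (show (n : G) • g • v = w from hn) ▸ hw
        -- By the slice property `n * g` fixes x, hence lies in N, and so does g.
        exact (N.mul_mem_cancel_left n.2).1 (hfixN x _ (hV.smul_eq _ v hv h1)) }
  obtain ⟨e, he⟩ := hp.surjective y
  -- The covering yields the opposite group of G ⧸ N; inversion identifies it with G ⧸ N.
  exact ⟨(hcov.fundamentalGroupEquiv ⟨e, he⟩).trans (MulEquiv.inv' (G ⧸ N)).symm⟩

end Slices

/-! ### Cartan linearization of finite stabilizers -/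

section Linearization

variable {E : Type*} [NormedAddCommGroup E] [NormedSpace ℂ E]
  {Z : Type*} [TopologicalSpace Z] [ChartedSpace E Z]

/-- The holomorphic inverse function theorem, for maps from a complex manifold to its model. -/
theorem exists_mem_maximalAtlas_eqOn_of_hasFDerivAt [CompleteSpace E] [IsManifold 𝓘(ℂ, E) ω Z]
    {f : Z → E} {ψ : OpenPartialHomeomorph Z E} (hψ : ψ ∈ IsManifold.maximalAtlas 𝓘(ℂ, E) ω Z)
    {z : Z} (hz : z ∈ ψ.source) (hf : ContDiffAt ℂ ω (f ∘ ψ.symm) (ψ z))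
    (hf' : HasFDerivAt (f ∘ ψ.symm) (ContinuousLinearMap.id ℂ E) (ψ z)) :
    ∃ φ ∈ IsManifold.maximalAtlas 𝓘(ℂ, E) ω Z, z ∈ φ.source ∧ EqOn φ f φ.source := by
  have hf'' : HasFDerivAt (f ∘ ψ.symm) ((ContinuousLinearEquiv.refl ℂ E : E ≃L[ℂ] E) : E →L[ℂ] E)
    (ψ z) := hf'
  let Φ := hf.toOpenPartialHomeomorph (f ∘ ψ.symm) hf'' (by simp)
  have hΦs : ψ z ∈ Φ.source := hf.mem_toOpenPartialHomeomorph_source hf'' (by simp)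
  have hΦ : ∀ v, Φ v = f (ψ.symm v) := fun v ↦ rfl
  have hinv : ContDiffAt ℂ ω Φ.symm (Φ (ψ z)) := hf.to_localInverse hf'' (by simp)
  have h1 : ∀ᶠ v in 𝓝 (ψ z), ContDiffAt ℂ ω Φ v := hf.eventually (by simp)
  have h2 : ∀ᶠ v in 𝓝 (ψ z), ContDiffAt ℂ ω Φ.symm (Φ v) :=
    (Φ.continuousAt hΦs).eventually (hinv.eventually (by simp))
  obtain ⟨S, hS, hSo, hzS⟩ := eventually_nhds_iff.1 (h1.and h2)
  let φ := ψ.trans (Φ.restr S)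
  have hsrc : ∀ x ∈ φ.source, x ∈ ψ.source ∧ ψ x ∈ Φ.source ∧ ψ x ∈ S := by
    intro x hx
    simpa [φ, hSo.interior_eq] using hx
  refine ⟨φ, ?_, ?_, ?_⟩
  · rw [IsManifold.mem_maximalAtlas_iff_contMDiffOn]
    constructor
    · intro x hx
      obtain ⟨hx1, hx2, hx3⟩ := hsrc x hx
      exact ((hS _ hx3).1.contMDiffAt.comp x
        (contMDiffAt_of_mem_maximalAtlas hψ hx1)).contMDiffWithinAt
    · intro y hy
      have hy' := φ.map_target hy
      obtain ⟨hx1, hx2, hx3⟩ := hsrc _ hy'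
      have hψy : ψ (φ.symm y) = Φ.symm y := by
        have h3 : Φ (ψ (φ.symm y)) = y := φ.right_inv hy
        rw [← h3, Φ.left_inv hx2, h3]
      have h4 : ContDiffAt ℂ ω Φ.symm y := by
        have := (hS _ hx3).2
        rwa [show Φ (ψ (φ.symm y)) = y from φ.right_inv hy] at this
      have h5 : ContMDiffAt 𝓘(ℂ, E) 𝓘(ℂ, E) ω ψ.symm (Φ.symm y) :=
        contMDiffAt_symm_of_mem_maximalAtlas hψ (hψy ▸ ψ.map_source hx1)
      exact (h5.comp y h4.contMDiffAt).contMDiffWithinAt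
  · simp [φ, hSo.interior_eq, hz, hΦs, hzS]
  · intro x hx
    obtain ⟨hx1, -, -⟩ := hsrc x hx
    change f (ψ.symm (ψ x)) = f x
    rw [ψ.left_inv hx1]

variable {Γ : Type*} [Group Γ] [MulAction Γ Z]

/-- Cartan's linearization of the stabilizer of a point, as a germ. -/
theorem exists_chart_eqOn_equivariant [CompleteSpace E] [IsManifold 𝓘(ℂ, E) ω Z]
    (hΓ : ∀ g : Γ, ContMDiff 𝓘(ℂ, E) 𝓘(ℂ, E) ω (fun x : Z ↦ g • x)) (z : Z)
    [Finite (MulAction.stabilizer Γ z)] :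
    ∃ φ ∈ IsManifold.maximalAtlas 𝓘(ℂ, E) ω Z, ∃ (f : Z → E)
      (A : MulAction.stabilizer Γ z → (E →L[ℂ] E)), z ∈ φ.source ∧ EqOn φ f φ.source ∧
      f z = 0 ∧ ∀ (h : MulAction.stabilizer Γ z) (x : Z), f ((h : Γ) • x) = A h (f x) := by
  classical
  have := Fintype.ofFinite (MulAction.stabilizer Γ z)
  let ψ := chartAt E z
  have hψ : ψ ∈ IsManifold.maximalAtlas 𝓘(ℂ, E) ω Z := IsManifold.chart_mem_maximalAtlas z
  have hzψ : z ∈ ψ.source := mem_chart_source E z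
  have hstab : ∀ h : MulAction.stabilizer Γ z, (h : Γ) • z = z := fun h ↦ h.2
  let F : MulAction.stabilizer Γ z → E → E := fun h v ↦ ψ ((h : Γ) • ψ.symm v)
  have hF : ∀ h, ContDiffAt ℂ ω (F h) (ψ z) := by
    intro h
    rw [← contMDiffAt_iff_contDiffAt]
    have h1 : ContMDiffAt 𝓘(ℂ, E) 𝓘(ℂ, E) ω ψ.symm (ψ z) :=
      contMDiffAt_symm_of_mem_maximalAtlas hψ (ψ.map_source hzψ)
    have h2 : ContMDiffAt 𝓘(ℂ, E) 𝓘(ℂ, E) ω (fun x : Z ↦ (h : Γ) • x) (ψ.symm (ψ z)) :=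
      (hΓ h).contMDiffAt
    have h3 : ContMDiffAt 𝓘(ℂ, E) 𝓘(ℂ, E) ω ψ ((h : Γ) • ψ.symm (ψ z)) := by
      rw [ψ.left_inv hzψ, hstab]
      exact contMDiffAt_of_mem_maximalAtlas hψ hzψ
    exact ContMDiffAt.comp (g := ψ) (f := fun v ↦ (h : Γ) • ψ.symm v) (ψ z) h3 (h2.comp _ h1)
  have hFz : ∀ h, F h (ψ z) = ψ z := fun h ↦ by
    simp only [F]
    rw [ψ.left_inv hzψ, hstab]
  let A : MulAction.stabilizer Γ z → (E →L[ℂ] E) := fun h ↦ fderiv ℂ (F h) (ψ z)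
  have hA : ∀ h, HasFDerivAt (F h) (A h) (ψ z) := fun h ↦
    ((hF h).differentiableAt (by simp)).hasFDerivAt
  have hA1 : A 1 = ContinuousLinearMap.id ℂ E := by
    refine (hA 1).unique ((hasFDerivAt_id _).congr_of_eventuallyEq ?_)
    filter_upwards [ψ.open_target.mem_nhds (ψ.map_source hzψ)] with v hv
    simp [F, ψ.right_inv hv]
  have hAmul : ∀ g h, A (g * h) = (A g).comp (A h) := by
    intro g h
    refine (hA (g * h)).unique (HasFDerivAt.congr_of_eventuallyEq
      (HasFDerivAt.comp (g := F g) (ψ z) (by rw [hFz]; exact hA g) (hA h)) ?_)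
    have h1 : ContinuousAt (fun v ↦ (h : Γ) • ψ.symm v) (ψ z) := by
      refine ContinuousAt.comp (g := fun x : Z ↦ (h : Γ) • x) ?_
        (ψ.continuousAt_symm (ψ.map_source hzψ))
      exact (hΓ h).continuous.continuousAt
    have h2 : ∀ᶠ v in 𝓝 (ψ z), (h : Γ) • ψ.symm v ∈ ψ.source := by
      refine h1.eventually (ψ.open_source.mem_nhds ?_)
      beta_reduce
      rw [ψ.left_inv hzψ, hstab]
      exact hzψ
    filter_upwards [h2] with v hv
    simp [F, ψ.left_inv hv, mul_smul]
  let c : ℂ := (Fintype.card (MulAction.stabilizer Γ z) : ℂ)⁻¹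
  -- Cartan's average of A_h⁻¹ ∘ ψ ∘ h, with derivative the identity at z. Its equivariance is a
  -- formal reindexing h ↦ hk, valid even where `ψ` takes junk values.
  let f : Z → E := fun x ↦ c • ∑ h : MulAction.stabilizer Γ z, A h⁻¹ (ψ ((h : Γ) • x) - ψ z)
  have hff : f ∘ ψ.symm = fun v ↦ c • ∑ h : MulAction.stabilizer Γ z, A h⁻¹ (F h v - ψ z) := rfl
  have hd : HasFDerivAt (f ∘ ψ.symm) (ContinuousLinearMap.id ℂ E) (ψ z) := by
    have h1 : HasFDerivAt (f ∘ ψ.symm)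
        (c • ∑ h : MulAction.stabilizer Γ z, (A h⁻¹).comp (A h)) (ψ z) := by
      rw [hff]
      refine HasFDerivAt.const_smul (HasFDerivAt.fun_sum fun h _ ↦ ?_) c
      exact (A h⁻¹).hasFDerivAt.comp (ψ z) ((hA h).sub_const (ψ z))
    convert h1
    simp_rw [← hAmul, inv_mul_cancel, hA1, Finset.sum_const, Finset.card_univ]
    rw [← Nat.cast_smul_eq_nsmul ℂ, smul_smul, inv_mul_cancel₀, one_smul]
    exact_mod_cast Fintype.card_ne_zero
  have hc : ContDiffAt ℂ ω (f ∘ ψ.symm) (ψ z) := by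
    rw [hff]
    refine ContDiffAt.const_smul c (ContDiffAt.sum fun h _ ↦ ?_)
    exact (A h⁻¹).contDiff.contDiffAt.comp (ψ z) ((hF h).sub contDiffAt_const)
  obtain ⟨φ, hφ, hzφ, hφf⟩ := exists_mem_maximalAtlas_eqOn_of_hasFDerivAt hψ hzψ hc hd
  refine ⟨φ, hφ, f, A, hzφ, hφf, ?_, ?_⟩
  · simp [f, hstab]
  · intro k x
    simp only [f, map_smul, map_sum]
    congr 1
    refine Fintype.sum_equiv (Equiv.mulRight k) _ _ fun h ↦ ?_
    have h1 : k * (h * k)⁻¹ = h⁻¹ := by group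
    rw [← ContinuousLinearMap.comp_apply, Equiv.coe_mulRight, ← hAmul, h1]
    simp [mul_smul]

/-- Cartan's linearization theorem: around a point, a properly discontinuous action by holomorphic
maps looks like the linear action of a finite group on an invariant convex open set. -/
theorem exists_linearizing_chart [FiniteDimensional ℂ E] [T2Space Z] [IsManifold 𝓘(ℂ, E) ω Z]
    [ProperlyDiscontinuousSMul Γ Z]
    (hΓ : ∀ g : Γ, ContMDiff 𝓘(ℂ, E) 𝓘(ℂ, E) ω (fun x : Z ↦ g • x)) (z : Z) {N : Set Z}
    (hN : N ∈ 𝓝 z) :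
    ∃ φ ∈ IsManifold.maximalAtlas 𝓘(ℂ, E) ω Z, ∃ A : MulAction.stabilizer Γ z → (E →L[ℂ] E),
      z ∈ φ.source ∧ φ.source ⊆ N ∧ φ z = 0 ∧ Convex ℝ φ.target ∧
      (∀ (h : MulAction.stabilizer Γ z), ∀ x ∈ φ.source,
        (h : Γ) • x ∈ φ.source ∧ φ ((h : Γ) • x) = A h (φ x)) ∧
      ∀ (g : Γ) (x : Z), x ∈ φ.source → g • x ∈ φ.source → g • z = z := by
  have := FiniteDimensional.complete ℂ E
  have := FiniteDimensional.proper ℂ E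
  have := ChartedSpace.locallyCompactSpace E Z
  have hcont : ContinuousConstSMul Γ Z := ⟨fun g ↦ (hΓ g).continuous⟩
  have hfin : Finite (MulAction.stabilizer Γ z) :=
    (ProperlyDiscontinuousSMul.finite_stabilizer z : (MulAction.stabilizer Γ z : Set Γ).Finite)
  obtain ⟨φ, hφ, f, A, hzφ, hφf, hfz, hfA⟩ := exists_chart_eqOn_equivariant hΓ z
  have hstab : ∀ h : MulAction.stabilizer Γ z, (h : Γ) • z = z := fun h ↦ h.2
  obtain ⟨U, hU, hUz⟩ := ProperlyDiscontinuousSMul.exists_nhds_image_smul_eq_self Γ z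
  let W₀ := φ.source ∩ interior (N ∩ U)
  have hW₀o : IsOpen W₀ := φ.open_source.inter isOpen_interior
  have hzW₀ : z ∈ W₀ := ⟨hzφ, mem_interior_iff_mem_nhds.2 (Filter.inter_mem hN hU)⟩
  let W := ⋂ h : MulAction.stabilizer Γ z, (fun x ↦ (h : Γ) • x) ⁻¹' W₀
  have hWo : IsOpen W := isOpen_iInter_of_finite fun h ↦ hW₀o.preimage (continuous_const_smul _)
  have hzW : z ∈ W := mem_iInter.2 fun h ↦ by
    rw [mem_preimage, hstab]
    exact hzW₀
  have hWW₀ : W ⊆ W₀ := fun x hx ↦ by simpa using mem_iInter.1 hx 1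
  have hWinv : ∀ (h : MulAction.stabilizer Γ z), ∀ x ∈ W, (h : Γ) • x ∈ W := by
    intro h x hx
    refine mem_iInter.2 fun k ↦ ?_
    have := mem_iInter.1 hx (k * h)
    simpa [mul_smul] using this
  have hφz : φ z = 0 := (hφf hzφ).trans hfz
  have himg : φ '' W ∈ 𝓝 (0 : E) := by
    rw [← hφz]
    exact (φ.isOpen_image_of_subset_source hWo (fun x hx ↦ (hWW₀ hx).1)).mem_nhds
      (mem_image_of_mem φ hzW)
  obtain ⟨r, hr, hrW⟩ := Metric.mem_nhds_iff.1 himg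
  -- Intersecting preimages of a ball under all `A h` gives a convex set with invariant preimage in
  -- `W`; the ball itself keeps D inside `φ '' W`.
  let D : Set E := Metric.ball 0 r ∩ ⋂ h : MulAction.stabilizer Γ z, A h ⁻¹' Metric.ball 0 r
  have hDo : IsOpen D := Metric.isOpen_ball.inter (isOpen_iInter_of_finite fun h ↦
    Metric.isOpen_ball.preimage (A h).continuous)
  let V := W ∩ φ ⁻¹' D
  have hVeq : V = W ∩ (φ.source ∩ φ ⁻¹' D) := by
    ext x
    exact ⟨fun hx ↦ ⟨hx.1, (hWW₀ hx.1).1, hx.2⟩, fun hx ↦ ⟨hx.1, hx.2.2⟩⟩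
  have hVo : IsOpen V := by
    rw [hVeq]
    exact hWo.inter (φ.isOpen_inter_preimage hDo)
  have hzV : z ∈ V := ⟨hzW, by simp [hφz, hr], mem_iInter.2 fun h ↦ by simp [hφz, hr]⟩
  have hVs : V ⊆ φ.source := fun x hx ↦ (hWW₀ hx.1).1
  have hAf : ∀ (h : MulAction.stabilizer Γ z), ∀ x ∈ W, φ ((h : Γ) • x) = A h (φ x) := by
    intro h x hx
    rw [hφf (hWW₀ (hWinv h x hx)).1, hφf (hWW₀ hx).1, hfA]
  have hVinv : ∀ (h : MulAction.stabilizer Γ z), ∀ x ∈ V, (h : Γ) • x ∈ V := by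
    intro h x hx
    have h0 := mem_iInter.1 hx.2.2 h
    rw [mem_preimage, ← hAf h x hx.1] at h0
    refine ⟨hWinv h x hx.1, h0, mem_iInter.2 fun k ↦ ?_⟩
    have h1 := mem_iInter.1 hx.2.2 (k * h)
    rw [mem_preimage] at h1 ⊢
    rw [← hAf k _ (hWinv h x hx.1), smul_smul]
    rw [← hAf _ x hx.1] at h1
    exact h1
  have htarget : (φ.restr V).target = D := by
    rw [← (φ.restr V).image_source_eq_target, φ.restr_source, hVo.interior_eq,
      inter_eq_right.2 hVs]
    apply Subset.antisymm
    · rintro _ ⟨x, hx, rfl⟩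
      exact hx.2
    · intro v hv
      obtain ⟨x, hx, rfl⟩ := hrW hv.1
      exact ⟨x, ⟨hx, hv⟩, rfl⟩
  refine ⟨φ.restr V, restr_mem_maximalAtlas _ hφ hVo, A, ?_, ?_, hφz, ?_, ?_, ?_⟩
  · rw [φ.restr_source, hVo.interior_eq]
    exact ⟨hzφ, hzV⟩
  · rw [φ.restr_source, hVo.interior_eq]
    exact fun x hx ↦ (interior_subset (hWW₀ hx.2.1).2).1
  · rw [htarget]
    exact (convex_ball (0 : E) r).inter (convex_iInter fun h ↦
      (convex_ball (0 : E) r).linear_preimage ((A h).restrictScalars ℝ).toLinearMap)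
  · rw [φ.restr_source, hVo.interior_eq, inter_eq_right.2 hVs]
    exact fun h x hx ↦ ⟨hVinv h x hx, hAf h x hx.1⟩
  · rw [φ.restr_source, hVo.interior_eq, inter_eq_right.2 hVs]
    exact fun g x hx hgx ↦ hUz g ⟨g • x, ⟨x, (interior_subset (hWW₀ hx.1).2).2, rfl⟩,
      (interior_subset (hWW₀ hgx.1).2).2⟩

end Linearization

/-! ### Slices and simple connectedness of invariant open sets -/

section InvariantOpenSets

variable {E : Type*} [NormedAddCommGroup E] [NormedSpace ℂ E] [FiniteDimensional ℂ E]
  {Z : Type*} [TopologicalSpace Z] [T2Space Z] [ChartedSpace E Z] [IsManifold 𝓘(ℂ, E) ω Z]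
  {Γ : Type*} [Group Γ] [MulAction Γ Z] [ProperlyDiscontinuousSMul Γ Z]

/-- Radial contraction to 0 in a linearizing chart commutes with the linear stabilizer action. -/
theorem exists_isContractibleSlice
    (hΓ : ∀ g : Γ, ContMDiff 𝓘(ℂ, E) 𝓘(ℂ, E) ω (fun x : Z ↦ g • x)) (S : SubMulAction Γ Z)
    (hS : IsOpen (S : Set Z)) (x : S) : ∃ V : Set S, IsContractibleSlice Γ x V := by
  obtain ⟨φ, -, A, hxφ, hφS, hφx, hconv, hA, hstab⟩ :=
    exists_linearizing_chart hΓ (x : Z) (hS.mem_nhds x.2)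
  have h0 : (0 : E) ∈ φ.target := hφx ▸ φ.map_source hxφ
  have hmem : ∀ z ∈ φ.source, ∀ t : I, (1 - (t : ℝ)) • φ z ∈ φ.target := by
    intro z hz t
    have := hconv (φ.map_source hz) h0 (sub_nonneg.2 t.2.2) t.2.1 (by ring)
    simpa using this
  let V : Set S := Subtype.val ⁻¹' φ.source
  let c : V × I → Z := fun p ↦ φ.symm ((1 - (p.2 : ℝ)) • φ p.1.1.1)
  have hc : ∀ p, c p ∈ φ.source := fun p ↦ φ.map_target (hmem _ p.1.2 p.2)
  have hcc : Continuous c := by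
    refine φ.continuousOn_symm.comp_continuous ?_ fun p ↦ hmem _ p.1.2 p.2
    have h1 : Continuous fun p : V × I ↦ 1 - (p.2 : ℝ) := by fun_prop
    refine h1.smul ?_
    exact φ.continuousOn.comp_continuous (by fun_prop) fun p ↦ p.1.2
  refine ⟨V, φ.open_source.preimage continuous_subtype_val, hxφ, ?_, ?_⟩
  · intro g v hv hgv
    exact Subtype.ext (hstab g v hv hgv)
  · refine ⟨⟨fun p ↦ ⟨⟨c p, hφS (hc p)⟩, hc p⟩, (hcc.subtype_mk _).subtype_mk _⟩, ?_, ?_, ?_⟩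
    · intro v
      refine Subtype.ext (Subtype.ext ?_)
      simp [c, φ.left_inv v.2]
    · intro v
      refine Subtype.ext (Subtype.ext ?_)
      simp only [ContinuousMap.coe_mk, c, Icc.coe_one, sub_self, zero_smul]
      rw [← hφx, φ.left_inv hxφ]
    · intro g v w t hw
      refine Subtype.ext ?_
      have hw' : w.1.1 = g • v.1.1 := congrArg Subtype.val hw
      have hg : g • (x : Z) = x := hstab g v.1.1 v.2 (hw' ▸ w.2)
      obtain ⟨h1, h2⟩ := hA ⟨g, hg⟩ _ (hc (v, t))
      obtain ⟨-, h3⟩ := hA ⟨g, hg⟩ _ v.2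
      have h4 : (1 - (t : ℝ)) • φ w.1.1 = A ⟨g, hg⟩ ((1 - (t : ℝ)) • φ v.1.1) := by
        rw [hw', h3]
        exact (((A ⟨g, hg⟩).restrictScalars ℝ).map_smul _ _).symm
      change φ.symm ((1 - (t : ℝ)) • φ w.1.1) = g • c (v, t)
      rw [← φ.left_inv h1, h2]
      simp only [c]
      rw [φ.right_inv (hmem _ v.2 t), h4]

/-- Removing from a simply connected manifold a closed invariant set of points fixed by nontrivial
elements, whose fixed loci have codimension at least two, leaves a simply connected manifold. -/
theorem simplyConnectedSpace_of_two_le_analyticCodim [SimplyConnectedSpace Z]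
    (hΓ : ∀ g : Γ, ContMDiff 𝓘(ℂ, E) 𝓘(ℂ, E) ω (fun x : Z ↦ g • x))
    (hcodim : ∀ g : Γ, g ≠ 1 → 2 ≤ analyticCodim E (MulAction.fixedBy Z g)) {S : Set Z}
    (hS : IsOpen S) (hfree : ∀ x ∉ S, ∃ g : Γ, g ≠ 1 ∧ g • x = x) : SimplyConnectedSpace S := by
  have := ChartedSpace.locallyPathConnectedSpace E Z
  refine simplyConnectedSpace_of_local_preimage ⟨Subtype.val, continuous_subtype_val⟩
    fun z N hN ↦ ?_
  obtain ⟨φ, hφ, A, hzφ, hφN, hφz, hconv, hA, hstab⟩ := exists_linearizing_chart hΓ z hN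
  refine ⟨φ.source, hφN, φ.open_source, hzφ, ?_⟩
  have hfin : Finite (MulAction.stabilizer Γ z) :=
    (ProperlyDiscontinuousSMul.finite_stabilizer z : (MulAction.stabilizer Γ z : Set Γ).Finite)
  -- In the chart, the fixed locus of h is the eigenspace of `A h` for the eigenvalue 1; this chart
  -- itself exhibits z as a regular point, so the codimension bound applies to `W h`.
  let W : {h : MulAction.stabilizer Γ z // h ≠ 1} → Submodule ℂ E := fun h ↦
    (A h.1 - ContinuousLinearMap.id ℂ E).ker
  have hWmem : ∀ h (v : E), v ∈ W h ↔ A h.1 v = v := fun h v ↦ by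
    simp [W, LinearMap.mem_ker, sub_eq_zero]
  have hfix : ∀ h, ∀ x ∈ φ.source, (h.1 : Γ) • x = x ↔ φ x ∈ W h := by
    intro h x hx
    obtain ⟨h1, h2⟩ := hA h.1 x hx
    rw [hWmem, ← h2]
    exact ⟨fun h3 ↦ by rw [h3], fun h3 ↦ φ.injOn h1 hx h3⟩
  have hW : ∀ h, 2 ≤ Module.finrank ℂ (E ⧸ W h) := by
    intro h
    have h1 : IsSubmanifoldAt (MulAction.fixedBy Z (h.1 : Γ)) z (W h) :=
      ⟨h.1.2, φ, hφ, hzφ, fun x hx ↦ hfix h x hx⟩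
    have h2 : analyticCodim E (MulAction.fixedBy Z (h.1 : Γ)) ≤
        (Module.finrank ℂ (E ⧸ W h) : ℕ∞) :=
      iInf_le_of_le z (iInf_le_of_le (W h) (iInf_le_of_le h1 le_rfl))
    exact_mod_cast (hcodim h.1 fun h3 ↦ h.2 (Subtype.ext h3)).trans h2
  let φ' := φ.restr S
  have hsource : φ'.source = φ.source ∩ S := by rw [φ.restr_source, hS.interior_eq]
  have hEfin : FiniteDimensional ℝ E := FiniteDimensional.complexToReal E
  have hO : IsSimplyConnected φ'.target := by
    refine hconv.isSimplyConnected_of_diff_subset_iUnion φ.open_target ⟨φ z, φ.map_source hzφ⟩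
      φ'.open_target inter_subset_left (fun h ↦ (W h).restrictScalars ℝ)
      (fun h ↦ (W h).restrictScalars_sup_span_pair_ne_top (hW h)) ?_
    rintro v ⟨hv, hvO⟩
    have hx := φ.map_target hv
    have hxS : φ.symm v ∉ S := by
      intro hxS
      refine hvO ?_
      rw [← φ.right_inv hv]
      exact φ'.map_source (hsource ▸ ⟨hx, hxS⟩)
    obtain ⟨g, hg, hgx⟩ := hfree _ hxS
    have hgz : g • z = z := hstab g _ hx (hgx.symm ▸ hx)
    refine mem_iUnion.2 ⟨⟨⟨g, hgz⟩, fun h ↦ hg (congrArg Subtype.val h)⟩, ?_⟩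
    have := (hfix ⟨⟨g, hgz⟩, fun h ↦ hg (congrArg Subtype.val h)⟩ _ hx).1 hgx
    rwa [φ.right_inv hv] at this
  have hB : IsSimplyConnected (φ.source ∩ S) := by
    rw [← hsource]
    have := hO.simplyConnectedSpace
    exact φ'.toHomeomorphSourceTarget.toHomotopyEquiv.simplyConnectedSpace
  rw [← Topology.IsEmbedding.subtypeVal.isSimplyConnected_image]
  simpa [Subtype.image_preimage_coe, inter_comm] using hB

end InvariantOpenSets

/-! ### The complex orbit space and the conclusion -/

section OrbitSpace

variable {E : Type*} [NormedAddCommGroup E] [NormedSpace ℂ E]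
  {Z : Type*} [TopologicalSpace Z] [ChartedSpace E Z]

theorem contMDiff_smul_holAut (𝒢 : Subgroup (HolAut E Z)) (g : 𝒢) :
    ContMDiff 𝓘(ℂ, E) 𝓘(ℂ, E) ω (fun x : Z ↦ g • x) :=
  g.1.2.1

instance (𝒢 : Subgroup (HolAut E Z)) : ContinuousConstSMul 𝒢 Z :=
  ⟨fun g ↦ (contMDiff_smul_holAut 𝒢 g).continuous⟩

theorem orbitProj_eq_iff (𝒢 : Subgroup (HolAut E Z)) (x y : Z) :
    orbitProj 𝒢 x = orbitProj 𝒢 y ↔ x ∈ MulAction.orbit 𝒢 y :=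
  Quotient.eq

theorem orbitProj_smul (𝒢 : Subgroup (HolAut E Z)) (g : 𝒢) (x : Z) :
    orbitProj 𝒢 (g • x) = orbitProj 𝒢 x :=
  (orbitProj_eq_iff 𝒢 _ _).2 ⟨g, rfl⟩

theorem isOpenQuotientMap_orbitProj (𝒢 : Subgroup (HolAut E Z)) :
    IsOpenQuotientMap (orbitProj 𝒢) :=
  MulAction.isOpenQuotientMap_quotientMk

/-- Points with trivial stabilizer map to regular points of the orbit space. -/
theorem orbitProj_mem_regularLocus [FiniteDimensional ℂ E] [T2Space Z] [IsManifold 𝓘(ℂ, E) ω Z]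
    (𝒢 : Subgroup (HolAut E Z)) [ProperlyDiscontinuousSMul 𝒢 Z] {z : Z}
    (hz : ∀ g : 𝒢, g • z = z → g = 1) : orbitProj 𝒢 z ∈ regularLocus 𝒢 := by
  obtain ⟨φ, hφ, -, hzφ, -, -, -, -, hstab⟩ :=
    exists_linearizing_chart (contMDiff_smul_holAut 𝒢) z Filter.univ_mem
  have hπ := isOpenQuotientMap_orbitProj 𝒢
  have hinj : InjOn (orbitProj 𝒢) φ.source := by
    intro x hx y hy hxy
    obtain ⟨g, rfl⟩ := (orbitProj_eq_iff 𝒢 _ _).1 hxy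
    have hg : g = 1 := hz g (hstab g y hy hx)
    subst hg
    exact one_smul 𝒢 y
  have : Nonempty Z := ⟨z⟩
  let e : OpenPartialHomeomorph Z (OrbitSpace 𝒢) :=
    OpenPartialHomeomorph.ofContinuousOpen (hinj.toPartialEquiv _ _)
      hπ.continuous.continuousOn hπ.isOpenMap φ.open_source
  have hes : e.source = φ.source := rfl
  let Φ := e.symm.trans φ
  have hΦs : Φ.source = orbitProj 𝒢 '' φ.source := by
    have h1 : e.target = orbitProj 𝒢 '' φ.source := rfl
    rw [← h1]
    refine inter_eq_left.2 fun y hy ↦ ?_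
    exact hes ▸ e.map_target hy
  have hΦ : ∀ x ∈ φ.source, Φ (orbitProj 𝒢 x) = φ x := fun x hx ↦ by
    change φ (e.symm (e x)) = φ x
    rw [e.left_inv hx]
  have hΦsymm : ∀ v, Φ.symm v = orbitProj 𝒢 (φ.symm v) := fun v ↦ rfl
  refine ⟨Φ, hΦs ▸ mem_image_of_mem _ hzφ, fun V hV hVΦ f ↦ ⟨fun hf ↦ ?_, fun hf ↦ ?_⟩⟩
  · rw [← contMDiffOn_iff_contDiffOn]
    refine ContMDiffOn.comp (g := f ∘ orbitProj 𝒢) (f := φ.symm) hf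
      ((contMDiffOn_symm_of_mem_maximalAtlas hφ).mono ?_) ?_
    · rintro _ ⟨y, hy, rfl⟩
      obtain ⟨x, hx, rfl⟩ := hΦs ▸ hVΦ hy
      rw [hΦ x hx]
      exact φ.map_source hx
    · rintro _ ⟨y, hy, rfl⟩
      obtain ⟨x, hx, rfl⟩ := hΦs ▸ hVΦ hy
      rw [mem_preimage, hΦ x hx, φ.left_inv hx]
      exact hy
  · have hΦV : IsOpen (Φ '' V) := Φ.isOpen_image_of_subset_source hV hVΦ
    intro x hx
    -- A point over V need not lie in the chart domain; some group element g moves it there.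
    obtain ⟨y, hy, hyx⟩ := hΦs ▸ hVΦ hx
    obtain ⟨g, rfl⟩ := (orbitProj_eq_iff 𝒢 _ _).1 hyx
    have hyV : φ (g • x) ∈ Φ '' V := by
      rw [← hΦ _ hy]
      exact mem_image_of_mem _ (hyx.symm ▸ hx)
    have h1 : ContMDiffAt 𝓘(ℂ, E) 𝓘(ℂ, ℂ) ω (f ∘ Φ.symm) (φ (g • x)) :=
      (hf.contDiffAt (hΦV.mem_nhds hyV)).contMDiffAt
    have h2 : ContMDiffAt 𝓘(ℂ, E) 𝓘(ℂ, E) ω φ (g • x) := contMDiffAt_of_mem_maximalAtlas hφ hy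
    have h3 : ContMDiffAt 𝓘(ℂ, E) 𝓘(ℂ, E) ω (fun x : Z ↦ g • x) x :=
      (contMDiff_smul_holAut 𝒢 g).contMDiffAt
    have h4 : ContMDiffAt 𝓘(ℂ, E) 𝓘(ℂ, ℂ) ω (fun x ↦ (f ∘ Φ.symm) (φ (g • x))) x :=
      ContMDiffAt.comp (g := f ∘ Φ.symm) (f := fun x ↦ φ (g • x)) x h1
        (ContMDiffAt.comp (g := φ) (f := fun x : Z ↦ g • x) x h2 h3)
    refine (h4.congr_of_eventuallyEq ?_).contMDiffWithinAt
    have h5 : ∀ᶠ x' in 𝓝 x, g • x' ∈ φ.source :=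
      (continuous_const_smul g).continuousAt.eventually (φ.open_source.mem_nhds hy)
    filter_upwards [h5] with x' hx'
    simp only [Function.comp_apply, hΦsymm]
    rw [φ.left_inv hx', orbitProj_smul]

/-- Conjugation by g carries Stab(z) to Stab(g • z), and π⁻¹(U) is invariant. -/
theorem stabilizerSubgroup_normal (𝒢 : Subgroup (HolAut E Z)) (U : Set (OrbitSpace 𝒢)) :
    (stabilizerSubgroup 𝒢 U).Normal := by
  refine ⟨fun n hn g ↦ ?_⟩
  have hle : stabilizerSubgroup 𝒢 U ≤
      (stabilizerSubgroup 𝒢 U).comap (MulAut.conj g).toMonoidHom := by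
    refine (Subgroup.closure_le _).2 fun h hh ↦ ?_
    obtain ⟨z, hzU, hz⟩ := mem_iUnion₂.1 hh
    refine Subgroup.subset_closure (mem_iUnion₂.2 ⟨g • z, ?_, ?_⟩)
    · rw [mem_preimage, orbitProj_smul]
      exact hzU
    · have hz' : h • z = z := hz
      change (g * h * g⁻¹) • g • z = g • z
      simp [mul_smul, hz']
  exact hle hn

end OrbitSpace

theorem mainTheorem2
    {E : Type*} [NormedAddCommGroup E] [NormedSpace ℂ E] [FiniteDimensional ℂ E]
    {Z : Type*} [TopologicalSpace Z] [T2Space Z] [ChartedSpace E Z] [IsManifold 𝓘(ℂ, E) ω Z]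
    [SimplyConnectedSpace Z]
    (𝒢 : Subgroup (HolAut E Z))
    (hproper : ProperlyDiscontinuousSMul 𝒢 Z)
    (hstab : ∀ z : Z, Finite (MulAction.stabilizer 𝒢 z))
    (hcodim : ∀ g : 𝒢, g ≠ 1 → 2 ≤ analyticCodim E (MulAction.fixedBy Z g))
    (U : Set (OrbitSpace 𝒢)) (hU : IsOpen U) (hreg : regularLocus 𝒢 ⊆ U) :
    PathConnectedSpace U ∧
    ∃ _ : (stabilizerSubgroup 𝒢 U).Normal,
      ∀ u : U, Nonempty (FundamentalGroup U u ≃* 𝒢 ⧸ stabilizerSubgroup 𝒢 U) := by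
  have hπ := isOpenQuotientMap_orbitProj 𝒢
  let S : SubMulAction 𝒢 Z :=
    { carrier := orbitProj 𝒢 ⁻¹' U
      smul_mem' := fun g x hx ↦ by
        rw [mem_preimage, orbitProj_smul]
        exact hx }
  have hS : IsOpen (S : Set Z) := hU.preimage hπ.continuous
  have hfree : ∀ x ∉ (S : Set Z), ∃ g : 𝒢, g ≠ 1 ∧ g • x = x := by
    intro x hx
    by_contra! h
    exact hx (hreg (orbitProj_mem_regularLocus 𝒢 fun g hg ↦ by
      by_contra hg1
      exact h g hg1 hg))
  have hsc : SimplyConnectedSpace S :=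
    simplyConnectedSpace_of_two_le_analyticCodim (contMDiff_smul_holAut 𝒢) hcodim hS hfree
  let f : S → U := U.restrictPreimage (orbitProj 𝒢)
  have hf : IsOpenQuotientMap f := hπ.restrictPreimage U
  have hfG : ∀ x y, f x = f y ↔ x ∈ MulAction.orbit 𝒢 y := by
    intro x y
    refine (Subtype.ext_iff.trans (orbitProj_eq_iff 𝒢 x.1 y.1)).trans ?_
    exact ⟨fun ⟨g, hg⟩ ↦ ⟨g, Subtype.ext hg⟩, fun ⟨g, hg⟩ ↦ ⟨g, congrArg Subtype.val hg⟩⟩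
  have hcont : ContinuousConstSMul 𝒢 S :=
    ⟨fun g ↦ ((continuous_const_smul g).comp continuous_subtype_val).subtype_mk _⟩
  refine ⟨hf.surjective.pathConnectedSpace hf.continuous, stabilizerSubgroup_normal 𝒢 U, ?_⟩
  have := stabilizerSubgroup_normal 𝒢 U
  refine nonempty_fundamentalGroup_orbitSpace_mulEquiv
    (exists_isContractibleSlice (contMDiff_smul_holAut 𝒢) S hS) hf hfG
    (stabilizerSubgroup 𝒢 U) ?_
  refine congrArg Subgroup.closure ?_
  ext g
  simp only [mem_iUnion]
  constructor
  · rintro ⟨z, hz, hg⟩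
    exact ⟨⟨z, hz⟩, Subtype.ext hg⟩
  · rintro ⟨z, hg⟩
    exact ⟨z, z.2, congrArg Subtype.val hg⟩
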